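/- **Setting.** Let $\alpha<\kappa$ be ordinals, let $\langle U_\gamma\mid\gamma<\alpha\rangle$ be normal ultrafilters on $\kappa$, and for $\gamma<\delta<\alpha$ let $f^\delta_\gamma$ be a function on $\kappa$ with $[f^\delta_\gamma]_{U_\delta}=U_\gamma$ in $\mathrm{Ult}(V,U_\delta)$, i.e. $X\in U_\gamma\iff\{\xi<\kappa\mid X\cap\xi\in f^\delta_\gamma(\xi)\}\in U_\delta$ for all $X\subseteq\kappa$ (so the sequence is increasing in the Mitchell order). For $\gamma<\alpha$ let $A_\gamma$ be the set of $\xi$ with $\alpha<\xi<\kappa$ such that $f^\gamma_\beta(\xi)$ is a normal ultrafilter on $\xi$ for all $\beta<\gamma$, and $[f^\eta_\beta\restriction\xi]_{f^\gamma_\eta(\xi)}=f^\gamma_\beta(\xi)$ for all $\beta<\eta<\gamma$. **Magidor forcing** $\mathbb M$ consists of the pairs $\langle g,G\rangle$ where $g$ is a strictly increasing function with finite domain $\mathrm{dom}(g)\subseteq\alpha$ and $g(\gamma)\in A_\gamma$; $G$ is a function with domain $\alpha\setminus\mathrm{dom}(g)$; for each $\gamma\in\alpha\setminus\mathrm{dom}(g)$,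 $G(\gamma)\subseteq A_\gamma$, and $G(\gamma)\in U_\gamma$ if $\mathrm{dom}(g)\subseteq\gamma$, while $G(\gamma)\in f^\rho_\gamma(g(\rho))$ if $\rho$ is the least element of $\mathrm{dom}(g)$ above $\gamma$; and every $\xi\in G(\gamma)$ satisfies $g(\beta)<\xi<g(\beta')$ whenever $\beta<\gamma<\beta'$ and $\beta$, respectively $\beta'$, is in $\mathrm{dom}(g)$. Put $\langle g',G'\rangle\le\langle g,G\rangle$ iff $g\subseteq g'$, $g'(\gamma)\in G(\gamma)$ for $\gamma\in\mathrm{dom}(g')\setminus\mathrm{dom}(g)$, and $G'(\gamma)\subseteq G(\gamma)$ for $\gamma\in\alpha\setminus\mathrm{dom}(g')$. The direct extension ordering is: $\langle g',G'\rangle\le_1\langle g,G\rangle$ iff $\langle g',G'\rangle\le\langle g,G\rangle$ and $g'=g$. A condition $\langle g,G\rangle$ is *pruned* if $G(\delta)\cap\xi\in f^\gamma_\delta(\xi)$ whenever $\gamma\in\alpha\setminus\mathrm{dom}(g)$, $\xi\in G(\gamma)$, $\delta<\gamma$ and $\mathrm{dom}(g)\cap[\delta,\gamma]=\emptyset$.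 **The strong Prikry property.** Let $\mathbb P$ be a partial order with weakest condition $\mathbf 1$, $\mathbb B$ its Boolean completion (the algebra of regular open sets), $e:\mathbb P\to\mathbb B$ the canonical map (if $\mathbb P$ is separative, this is the embedding $p\mapsto\{q\mid q\le p\}$), and $\le_1$ a binary relation on $\mathbb P$. For $b\in\mathbb B$, $p\in\mathbb P$ write $b\le_1p$ iff $b\le e(p)$ and there is $q\in\mathbb P$ with $q\le_1p$ and $e(q)\le b$. Then $\langle\mathbb P,\le,\le_1\rangle$ has the *strong Prikry property* if $\le_1$ is reflexive and contained in $\le$, and 0. (Prikry property) for every statement $\varphi$ of the forcing language (equivalently, every Boolean value $b\in\mathbb B$) and every $p\in\mathbb P$ there is $q\le_1p$ deciding $\varphi$ (equivalently, with $e(q)\le b$ or $e(q)\le\neg b$); 1. (directed) if $q,r\le_1p$, there is $s\le_1p$ with $s\le q$ and $s\le r$; 2. (connected) if $q\le_1p$ and $q\le q'\le p$, then $q'\le_1p$; 3. (maximal antichains are captured) for every maximal antichain $A\subseteq\mathbb P$ and every $f:A\to\mathbb B$ with $f(a)\le e(a)$ for all $a\in A$, $$\bigvee\{f(a)\mid a\in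 A\}\le_1\mathbf 1\iff\bigvee\{e(a)\mid a\in A,\ f(a)\le_1a\}\le_1\mathbf 1.$$ **Theorem.** Magidor forcing $\mathbb M$ has a weakest condition, and with the direct extension ordering $\le_1$ it has the strong Prikry property. Moreover, every condition of $\mathbb M$ has a pruned direct extension, and the suborder of $\mathbb M$ formed by the pruned conditions is separative, has a weakest condition, and has the strong Prikry property with respect to $\le_1$ as well. -/

import Mathlib

universe u

/-! ## Notions of forcing, Boolean completions and the strong Prikry property -/

namespace Forcing

section Poset

variable {P : Type*} [PartialOrder P]

/-- Two conditions are compatible if they have a common extension (`q ≤ p`: `q` extends `p`). -/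
def Compatible (p q : P) : Prop := ∃ r, r ≤ p ∧ r ≤ q

/-- A poset is separative if whenever `p ≰ q`, some extension of `p` is incompatible with `q`. -/
def IsSeparative (P : Type*) [PartialOrder P] : Prop :=
  ∀ p q : P, ¬ p ≤ q → ∃ r ≤ p, ¬ Compatible r q

/-- `A` is a maximal antichain: its elements are pairwise incompatible, and every condition is
compatible with an element of `A`. -/
def IsMaximalAntichain (A : Set P) : Prop :=
  (∀ a ∈ A, ∀ b ∈ A, a ≠ b → ¬ Compatible a b) ∧ ∀ p : P, ∃ a ∈ A, Compatible p a

/-- The Boolean completion of a poset: the complete Boolean algebra of its regular open sets,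
i.e. of the regular elements of the Heyting algebra of open (= downward closed) sets. -/
abbrev BooleanCompletion (P : Type*) [PartialOrder P] : Type _ := Heyting.Regular (LowerSet P)

/-- The canonical map of a poset to its Boolean completion. It sends `p` to the regularization of
`{q | q ≤ p}`, which is the set `{q | q ≤ p}` itself if the poset is separative
(see `mem_embed_of_isSeparative`). -/
def embed (p : P) : BooleanCompletion P := Heyting.Regular.toRegular (LowerSet.Iic p)

/-- The join (supremum) of a set of elements of the Boolean completion. -/
def join (S : Set (BooleanCompletion P)) : BooleanCompletion P :=
  Heyting.Regular.toRegular (⨆ b ∈ S, (b : LowerSet P))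

theorem isLUB_join (S : Set (BooleanCompletion P)) : IsLUB S (join S) := by
  constructor
  · intro b hb
    rw [← Heyting.Regular.toRegular_coe b]
    exact Heyting.Regular.toRegular.monotone
      (le_iSup₂ (f := fun (b : BooleanCompletion P) (_ : b ∈ S) => (b : LowerSet P)) b hb)
  · intro c hc
    rw [join, Heyting.Regular.gi.gc.le_iff_le]
    exact iSup₂_le fun b hb => hc hb

theorem mem_compl_lowerSet (s : LowerSet P) (p : P) :
    p ∈ sᶜ ↔ ∀ q ≤ p, q ∉ s := by
  constructor
  · intro h q hq hs
    have h1 : q ∈ s ⊓ sᶜ := ⟨hs, (sᶜ).lower hq h⟩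
    rw [inf_compl_self] at h1
    exact h1
  · intro h
    have h1 : LowerSet.Iic p ≤ sᶜ := by
      rw [le_compl_iff_disjoint_right, disjoint_iff_inf_le]
      rintro q ⟨hq, hs⟩
      exact (h q hq hs).elim
    exact h1 (le_refl p)

/-- `q` lies in the image of `p` in the completion iff every extension of `q` is compatible with
`p`, i.e. iff `q` forces `p` into the generic filter. -/
theorem mem_embed (p q : P) :
    q ∈ (embed p : LowerSet P) ↔ ∀ r ≤ q, Compatible r p := by
  simp only [embed, Heyting.Regular.coe_toRegular, mem_compl_lowerSet]
  constructor
  · intro h r hr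
    have := h r hr
    push Not at this
    obtain ⟨s, hs, hp⟩ := this
    exact ⟨s, hs, hp⟩
  · intro h r hr hcon
    obtain ⟨s, hs, hp⟩ := h r hr
    exact hcon s hs hp

theorem mem_embed_of_isSeparative (hP : IsSeparative P) (p q : P) :
    q ∈ (embed p : LowerSet P) ↔ q ≤ p := by
  rw [mem_embed]
  constructor
  · intro h
    by_contra hqp
    obtain ⟨r, hr, hc⟩ := hP q p hqp
    exact hc (h r hr)
  · intro h r hr
    exact ⟨r, le_rfl, hr.trans h⟩

/-- The extension of a direct extension relation `≤₁` on `P` to elements `b` of the completion: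
`b ≤₁ p` iff `b ≤ p` and there is a condition `q ≤₁ p` with `q ≤ b`. -/
def ExtLE (le₁ : P → P → Prop) (b : BooleanCompletion P) (p : P) : Prop :=
  b ≤ embed p ∧ ∃ q, le₁ q p ∧ embed q ≤ b

/-- The Prikry property of `⟨P, ≤, ≤₁⟩`: every statement of the forcing language is decided by a
direct extension of any given condition. A statement enters through its Boolean value `b`: a
condition `q` forces it iff `q ≤ b`, and forces its negation iff `q ≤ bᶜ`; every element `b` of
the completion is the value of a statement, namely of `b ∈ Ġ`. -/
def PrikryProperty (le₁ : P → P → Prop) : Prop :=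
  ∀ (b : BooleanCompletion P) (p : P), ∃ q, le₁ q p ∧ (embed q ≤ b ∨ embed q ≤ bᶜ)

/-- The strong Prikry property of `⟨P, ≤, ≤₁⟩`. In `captures`, `f` is used only on `A`. -/
structure StrongPrikryProperty (le₁ : P → P → Prop) : Prop where
  refl : ∀ p, le₁ p p
  le_of_le₁ : ∀ q p, le₁ q p → q ≤ p
  /-- `P` has a weakest condition. -/
  exists_top : ∃ one : P, IsTop one
  prikry : PrikryProperty le₁
  directed : ∀ p q r, le₁ q p → le₁ r p → ∃ s, le₁ s p ∧ s ≤ q ∧ s ≤ r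
  connected : ∀ p q q', le₁ q p → q ≤ q' → q' ≤ p → le₁ q' p
  captures : ∀ one : P, IsTop one → ∀ A : Set P, IsMaximalAntichain A →
    ∀ f : P → BooleanCompletion P, (∀ a ∈ A, f a ≤ embed a) →
      (ExtLE le₁ (join (f '' A)) one ↔
        ExtLE le₁ (join (embed '' {a ∈ A | ExtLE le₁ (f a) a})) one)

end Poset

end Forcing

/-! ## Magidor forcing -/

namespace Magidor

/-- `W` is a normal ultrafilter on the ordinal `κ`: a nonprincipal, `κ`-complete ultrafilter that
is closed under diagonal intersections. An ultrafilter on `κ` is given as an ultrafilter on the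
class of ordinals to which the set `κ = {ξ | ξ < κ}` belongs. (The conditions imply that `κ` is an
uncountable cardinal, hence measurable.) -/
structure IsNormalUltrafilter (κ : Ordinal.{u}) (W : Ultrafilter Ordinal.{u}) : Prop where
  mem : Set.Iio κ ∈ W
  nonprincipal : ∀ ξ : Ordinal.{u}, {ξ} ∉ W
  complete : ∀ μ < κ, ∀ X : Ordinal.{u} → Set Ordinal.{u},
    (∀ i < μ, X i ∈ W) → {ξ | ∀ i < μ, ξ ∈ X i} ∈ W
  normal : ∀ X : Ordinal.{u} → Set Ordinal.{u},
    (∀ i < κ, X i ∈ W) → {ξ | ∀ i < ξ, ξ ∈ X i} ∈ W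

/-- `[h]_W = Z`: the function `h` represents the ultrafilter `Z` on `κ` in the ultrapower of the
universe by the normal ultrafilter `W` on `κ`. Since `W` is normal, a set `X ⊆ κ` is represented
by `ξ ↦ X ∩ ξ`, so this says that `X ∈ Z` iff `X ∩ ξ ∈ h ξ` for `W`-almost all `ξ`. -/
def Represents (W : Ultrafilter Ordinal.{u}) (h : Ordinal.{u} → Ultrafilter Ordinal.{u})
    (Z : Ultrafilter Ordinal.{u}) : Prop :=
  ∀ X : Set Ordinal.{u}, X ∈ Z ↔ {ξ | X ∩ Set.Iio ξ ∈ h ξ} ∈ W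

/-- The parameters of Magidor forcing: an ordinal `α < κ`, a sequence `⟨U γ | γ < α⟩` of normal
ultrafilters on `κ` that is increasing in the Mitchell order, as witnessed by functions `f δ γ`
(for `γ < δ < α`) with `[f δ γ]_{U δ} = U γ`. -/
structure IsMagidorSystem (κ α : Ordinal.{u}) (U : Set.Iio α → Ultrafilter Ordinal.{u})
    (f : Set.Iio α → Set.Iio α → Ordinal.{u} → Ultrafilter Ordinal.{u}) : Prop where
  lt : α < κ
  normal : ∀ γ, IsNormalUltrafilter κ (U γ)
  represents : ∀ γ δ, γ < δ → Represents (U δ) (f δ γ) (U γ)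

/-- The set `A γ` of the points `ξ` in `(α, κ)` to which the system reflects: the `f γ β ξ`, for
`β < γ`, are normal ultrafilters on `ξ`, and `[f η β ↾ ξ] = f γ β ξ` in the ultrapower by
`f γ η ξ`, for `β < η < γ`. -/
def goodSet (κ α : Ordinal.{u})
    (f : Set.Iio α → Set.Iio α → Ordinal.{u} → Ultrafilter Ordinal.{u}) (γ : Set.Iio α) :
    Set Ordinal.{u} :=
  {ξ | α < ξ ∧ ξ < κ ∧ (∀ β < γ, IsNormalUltrafilter ξ (f γ β ξ)) ∧
    ∀ β η, β < η → η < γ → Represents (f γ η ξ) (f η β) (f γ β ξ)}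

/-- A condition `⟨g, G⟩` of Magidor forcing. Here `g` is a partial function with finite domain
`dom ⊆ α`, and `G` is a function with domain `α \ dom`; both are extended by the dummy values `0`
and `∅` to all of `α`. -/
@[ext]
structure Condition (κ α : Ordinal.{u}) (U : Set.Iio α → Ultrafilter Ordinal.{u})
    (f : Set.Iio α → Set.Iio α → Ordinal.{u} → Ultrafilter Ordinal.{u}) where
  dom : Finset (Set.Iio α)
  g : Set.Iio α → Ordinal.{u}
  G : Set.Iio α → Set Ordinal.{u}
  g_dummy : ∀ γ ∉ dom, g γ = 0
  G_dummy : ∀ γ ∈ dom, G γ = ∅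
  g_mem : ∀ γ ∈ dom, g γ ∈ goodSet κ α f γ
  g_strictMono : ∀ β ∈ dom, ∀ γ ∈ dom, β < γ → g β < g γ
  G_subset : ∀ γ ∉ dom, G γ ⊆ goodSet κ α f γ
  /-- Above `max dom`, the sets `G γ` are in `U γ`. -/
  G_mem_top : ∀ γ ∉ dom, (∀ β ∈ dom, β < γ) → G γ ∈ U γ
  /-- If `ρ` is the least element of `dom` above `γ`, then `G γ` is in `f ρ γ (g ρ)`. -/
  G_mem : ∀ γ ∉ dom, ∀ ρ ∈ dom, γ < ρ → (∀ β ∈ dom, γ < β → ρ ≤ β) → G γ ∈ f ρ γ (g ρ)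
  /-- The elements of `G γ` lie strictly between the values of `g` to the left and right of `γ`. -/
  lt_of_mem_G : ∀ γ ∉ dom, ∀ β ∈ dom, β < γ → ∀ ξ ∈ G γ, g β < ξ
  mem_G_lt : ∀ γ ∉ dom, ∀ β ∈ dom, γ < β → ∀ ξ ∈ G γ, ξ < g β

namespace Condition

variable {κ α : Ordinal.{u}} {U : Set.Iio α → Ultrafilter Ordinal.{u}}
  {f : Set.Iio α → Set.Iio α → Ordinal.{u} → Ultrafilter Ordinal.{u}}

/-- `⟨g', G'⟩ ≤ ⟨g, G⟩` iff `g'` extends `g`, the new values `g' γ` are in `G γ`, and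
`G' γ ⊆ G γ` for all `γ` in `α \ dom g'`. -/
instance : PartialOrder (Condition κ α U f) where
  le q p := p.dom ⊆ q.dom ∧ (∀ γ ∈ p.dom, q.g γ = p.g γ) ∧
    (∀ γ ∈ q.dom, γ ∉ p.dom → q.g γ ∈ p.G γ) ∧ ∀ γ ∉ q.dom, q.G γ ⊆ p.G γ
  le_refl p := ⟨subset_rfl, fun _ _ => rfl, fun _ h h' => (h' h).elim, fun _ _ => subset_rfl⟩
  le_trans := by
    rintro r q p ⟨h1, h2, h3, h4⟩ ⟨k1, k2, k3, k4⟩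
    refine ⟨k1.trans h1, fun γ hγ => (h2 γ (k1 hγ)).trans (k2 γ hγ), fun γ hr hp => ?_,
      fun γ hr => (h4 γ hr).trans (k4 γ fun hq => hr (h1 hq))⟩
    by_cases hq : γ ∈ q.dom
    · rw [h2 γ hq]
      exact k3 γ hq hp
    · exact k4 γ hq (h3 γ hr hq)
  le_antisymm := by
    rintro q p ⟨h1, h2, -, h4⟩ ⟨k1, -, -, k4⟩
    have hd : q.dom = p.dom := k1.antisymm h1
    refine Condition.ext hd (funext fun γ => ?_) (funext fun γ => ?_)
    · by_cases hγ : γ ∈ p.dom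
      · exact h2 γ hγ
      · rw [p.g_dummy γ hγ, q.g_dummy γ (hd ▸ hγ)]
    · by_cases hγ : γ ∈ p.dom
      · rw [p.G_dummy γ hγ, q.G_dummy γ (hd ▸ hγ)]
      · exact (h4 γ (hd ▸ hγ)).antisymm (k4 γ hγ)

/-- The direct extension ordering: `⟨g', G'⟩ ≤₁ ⟨g, G⟩` iff `⟨g', G'⟩ ≤ ⟨g, G⟩` and `g' = g`. -/
def DirectLE (q p : Condition κ α U f) : Prop := q ≤ p ∧ q.dom = p.dom ∧ q.g = p.g

/-- A condition `⟨g, G⟩` is pruned if for every `γ` not in the domain of `g` and every `ξ ∈ G γ`,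
the value `ξ` can be added at `γ`: for all `δ < γ` such that `dom g` has no element in `[δ, γ]`,
the set `G δ ∩ ξ` belongs to `f γ δ ξ`. -/
def IsPruned (p : Condition κ α U f) : Prop :=
  ∀ γ ∉ p.dom, ∀ ξ ∈ p.G γ, ∀ δ < γ, (∀ β ∈ p.dom, ¬ (δ ≤ β ∧ β ≤ γ)) →
    p.G δ ∩ Set.Iio ξ ∈ f γ δ ξ

end Condition

/-- The suborder of the pruned conditions of Magidor forcing. -/
abbrev PrunedCondition (κ α : Ordinal.{u}) (U : Set.Iio α → Ultrafilter Ordinal.{u})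
    (f : Set.Iio α → Set.Iio α → Ordinal.{u} → Ultrafilter Ordinal.{u}) : Type (u + 1) :=
  {p : Condition κ α U f // p.IsPruned}

/-- The direct extension ordering on the pruned conditions. -/
def PrunedCondition.DirectLE {κ α : Ordinal.{u}} {U : Set.Iio α → Ultrafilter Ordinal.{u}}
    {f : Set.Iio α → Set.Iio α → Ordinal.{u} → Ultrafilter Ordinal.{u}}
    (q p : PrunedCondition κ α U f) : Prop :=
  q.val.DirectLE p.val

end Magidor

/-! ### Reducing the strong Prikry property to statements about conditions only. -/

namespace Forcing

section Poset

variable {P : Type*} [PartialOrder P]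

/-! Two conditions with the same stem have a common direct extension, so everything rests on making
properties of stems homogeneous. For a fixed finite set of new indices, the new values range over a
product of normal ultrafilters; diagonal intersections give measure-one sets on whose increasing
sequences a given property is constant (`exists_homogeneous`). A condition involves at most `|α|`
many properties and index sets, and all its measures are complete enough to treat them at once
(`exists_directLE_homogeneous`).

Prikry property: make "some condition in `b` has this stem" homogeneous for every domain. If one
extension of the resulting `q` lies in `b`, then any other extension can be brought to the same
domain as an extension of the first; its stem is then that of a condition in `b`, with which it is
compatible.

Antichains: clause 3 follows once direct extensions `d a` of the members `a` of an antichain are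
captured by one direct extension of the top (`CapturesDirectExtensions`), where `d a` is chosen to
decide `f a`. An antichain has at most one member with a given stem. Hence "the new value at `γ` is
allowed by the pruned refinement `e a` of `d a`, if the rest of the stem is that of `a`" is
realizable over every stem, and its homogeneous truth value is true. Prunedness then makes any `r`
below `a` whose new values are all allowed compatible with `e a`.

Adding points and pruning depend on reflection: if `U δ` is represented by `f γ δ` modulo `U γ`,
then a set in `U δ` reflects to a set in `f γ δ ξ` for almost all `ξ`, and the points of `goodSet`
repeat this situation below themselves. -/

theorem embed_le_iff (p : P) (b : BooleanCompletion P) : embed p ≤ b ↔ p ∈ (b : LowerSet P) := by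
  rw [embed, Heyting.Regular.gi.gc.le_iff_le]
  exact LowerSet.Iic_le

theorem mem_join (S : Set (BooleanCompletion P)) (p : P) :
    p ∈ (join S : LowerSet P) ↔ ∀ q ≤ p, ∃ r ≤ q, ∃ b ∈ S, r ∈ (b : LowerSet P) := by
  simp only [join, Heyting.Regular.coe_toRegular, mem_compl_lowerSet, LowerSet.mem_iSup_iff]
  push Not
  simp only [exists_prop]

theorem mem_of_forall_exists_le (b : BooleanCompletion P) {p : P}
    (h : ∀ q ≤ p, ∃ r ≤ q, r ∈ (b : LowerSet P)) : p ∈ (b : LowerSet P) := by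
  have hb : ((b : LowerSet P)ᶜ)ᶜ = b := b.2
  rw [← hb, mem_compl_lowerSet]
  intro q hq hqb
  obtain ⟨r, hr, hrb⟩ := h q hq
  exact (mem_compl_lowerSet _ _).1 hqb r hr hrb

theorem mem_coe_compl (b : BooleanCompletion P) (p : P) :
    p ∈ ((bᶜ : BooleanCompletion P) : LowerSet P) ↔ ∀ q ≤ p, q ∉ (b : LowerSet P) := by
  rw [Heyting.Regular.coe_compl, mem_compl_lowerSet]

theorem mem_embed_self (p : P) : p ∈ (embed p : LowerSet P) :=
  (mem_embed p p).2 fun r hr => ⟨r, le_rfl, hr⟩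

/-- The Prikry property for downward closed sets: some direct extension of `p` has no extension
in `b`, or densely many. -/
def OpenPrikryProperty (le₁ : P → P → Prop) : Prop :=
  ∀ (b : LowerSet P) (p : P), ∃ q, le₁ q p ∧ ((∀ r ≤ q, r ∉ b) ∨ ∀ r ≤ q, ∃ s ≤ r, s ∈ b)

/-- Direct extensions of the elements of an antichain are captured by a single direct extension
of the condition `one`. -/
def CapturesDirectExtensions (le₁ : P → P → Prop) (one : P) : Prop :=
  ∀ A : Set P, (∀ a ∈ A, ∀ b ∈ A, a ≠ b → ¬ Compatible a b) →
    ∀ d : P → P, (∀ a ∈ A, le₁ (d a) a) →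
      ∃ q, le₁ q one ∧ ∀ a ∈ A, ∀ r ≤ q, r ≤ a → Compatible r (d a)

theorem OpenPrikryProperty.prikryProperty {le₁ : P → P → Prop} (h : OpenPrikryProperty le₁) :
    PrikryProperty le₁ := by
  intro b p
  obtain ⟨q, hq, hb | hb⟩ := h b p
  · exact ⟨q, hq, Or.inr ((embed_le_iff _ _).2 ((mem_coe_compl _ _).2 hb))⟩
  · exact ⟨q, hq, Or.inl ((embed_le_iff _ _).2 (mem_of_forall_exists_le b hb))⟩

/-- Let `d a` be a direct extension of `a` deciding `f a`. By directedness, `f a ≤₁ a` holds exactly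
if the decision is positive. Below a capturing `q'`, every condition below some `a` meets `d a`, so
there `f a` and the part of `a` with positive decision agree densely. -/
theorem CapturesDirectExtensions.extLE_join_iff {le₁ : P → P → Prop} {one : P}
    (hone : IsTop one) (prikry : PrikryProperty le₁)
    (directed : ∀ p q r, le₁ q p → le₁ r p → ∃ s, le₁ s p ∧ s ≤ q ∧ s ≤ r)
    (h : CapturesDirectExtensions le₁ one) (A : Set P)
    (hA : ∀ a ∈ A, ∀ b ∈ A, a ≠ b → ¬ Compatible a b)
    (f : P → BooleanCompletion P) (hf : ∀ a ∈ A, f a ≤ embed a) :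
    ExtLE le₁ (join (f '' A)) one ↔
      ExtLE le₁ (join (embed '' {a ∈ A | ExtLE le₁ (f a) a})) one := by
  have htop : ∀ b : BooleanCompletion P, b ≤ embed one := fun b q _ =>
    (mem_embed one q).2 fun r _ => ⟨r, le_rfl, hone r⟩
  choose d hd hdec using fun a => prikry (f a) a
  obtain ⟨q', hq', hcap⟩ := h A hA d fun a _ => hd a
  constructor
  · rintro ⟨-, q, hq, hqb⟩
    obtain ⟨s, hs, hsq, hsq'⟩ := directed one q q' hq hq'
    refine ⟨htop _, s, hs, (embed_le_iff _ _).2 ((mem_join _ _).2 fun t ht => ?_)⟩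
    obtain ⟨r, hr, _, ⟨a, ha, rfl⟩, hra⟩ :=
      (mem_join _ _).1 ((embed_le_iff _ _).1 hqb) t (ht.trans hsq)
    obtain ⟨r', hr', hr'a⟩ := (mem_embed _ _).1 (hf a ha hra) r le_rfl
    obtain ⟨r₂, hr₂, hr₂d⟩ := hcap a ha r' (hr'.trans (hr.trans (ht.trans hsq'))) hr'a
    have hmem : r₂ ∈ (f a : LowerSet P) := (f a : LowerSet P).lower (hr₂.trans hr') hra
    refine ⟨r₂, hr₂.trans (hr'.trans hr), _, ⟨a, ⟨ha, hf a ha, d a, hd a, ?_⟩, rfl⟩,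
      (embed a : LowerSet P).lower (hr₂.trans hr'a) (mem_embed_self a)⟩
    refine (hdec a).resolve_right fun hneg => ?_
    exact (mem_coe_compl _ _).1 ((embed_le_iff _ _).1 hneg) r₂ hr₂d hmem
  · rintro ⟨-, q, hq, hqb⟩
    obtain ⟨s, hs, hsq, hsq'⟩ := directed one q q' hq hq'
    refine ⟨htop _, s, hs, (embed_le_iff _ _).2 ((mem_join _ _).2 fun t ht => ?_)⟩
    obtain ⟨r, hr, _, ⟨a, ⟨ha, -, q₁, hq₁, hq₁f⟩, rfl⟩, hra⟩ :=
      (mem_join _ _).1 ((embed_le_iff _ _).1 hqb) t (ht.trans hsq)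
    obtain ⟨r', hr', hr'a⟩ := (mem_embed _ _).1 hra r le_rfl
    obtain ⟨r₂, hr₂, hr₂d⟩ := hcap a ha r' (hr'.trans (hr.trans (ht.trans hsq'))) hr'a
    refine ⟨r₂, hr₂.trans (hr'.trans hr), f a, ⟨a, ha, rfl⟩, ?_⟩
    refine (f a : LowerSet P).lower hr₂d ((embed_le_iff _ _).1 ((hdec a).resolve_right ?_))
    intro hneg
    obtain ⟨w, -, hwd, hwq⟩ := directed a (d a) q₁ (hd a) hq₁
    exact (mem_coe_compl _ _).1 ((embed_le_iff _ _).1 hneg) w hwd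
      ((f a : LowerSet P).lower hwq ((embed_le_iff _ _).1 hq₁f))

theorem StrongPrikryProperty.of_capturesDirectExtensions {le₁ : P → P → Prop} {one : P}
    (hone : IsTop one) (refl : ∀ p, le₁ p p) (le_of_le₁ : ∀ q p, le₁ q p → q ≤ p)
    (prikry : OpenPrikryProperty le₁)
    (directed : ∀ p q r, le₁ q p → le₁ r p → ∃ s, le₁ s p ∧ s ≤ q ∧ s ≤ r)
    (connected : ∀ p q q', le₁ q p → q ≤ q' → q' ≤ p → le₁ q' p)
    (captures : CapturesDirectExtensions le₁ one) : StrongPrikryProperty le₁ where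
  refl := refl
  le_of_le₁ := le_of_le₁
  exists_top := ⟨one, hone⟩
  prikry := prikry.prikryProperty
  directed := directed
  connected := connected
  captures one' hone' A hA f hf := by
    obtain rfl : one' = one := (hone one').antisymm (hone' one)
    exact captures.extLE_join_iff hone' prikry.prikryProperty directed A hA.1 f hf

/-- The combinatorial Prikry property passes to a suborder into which every condition can be
directly extended. -/
theorem OpenPrikryProperty.subtype {le₁ : P → P → Prop} {S : P → Prop}
    (trans : ∀ p q r, le₁ r q → le₁ q p → le₁ r p) (le_of_le₁ : ∀ q p, le₁ q p → q ≤ p)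
    (hS : ∀ p, ∃ q, S q ∧ le₁ q p) (h : OpenPrikryProperty le₁) :
    OpenPrikryProperty fun q p : {p // S p} => le₁ q.1 p.1 := by
  intro b p
  obtain ⟨q, hq, hb⟩ := h ⟨{r | ∃ n ∈ b, r ≤ n.1}, fun r s hsr ⟨n, hn, hrn⟩ =>
    ⟨n, hn, hsr.trans hrn⟩⟩ p.1
  obtain ⟨q', hq'S, hq'⟩ := hS q
  refine ⟨⟨q', hq'S⟩, trans _ _ _ hq' hq, hb.imp (fun hb r hr hrb => ?_) fun hb r hr => ?_⟩
  · exact hb r.1 (le_trans hr (le_of_le₁ _ _ hq')) ⟨r, hrb, le_rfl⟩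
  · obtain ⟨s, hsr, n, hn, hsn⟩ := hb r.1 (le_trans hr (le_of_le₁ _ _ hq'))
    obtain ⟨s', hs'S, hs'⟩ := hS s
    have hs's := le_of_le₁ _ _ hs'
    exact ⟨⟨s', hs'S⟩, hs's.trans hsr, b.lower (a := n) (hs's.trans hsn) hn⟩

theorem CapturesDirectExtensions.subtype {le₁ : P → P → Prop} {S : P → Prop}
    (trans : ∀ p q r, le₁ r q → le₁ q p → le₁ r p) (le_of_le₁ : ∀ q p, le₁ q p → q ≤ p)
    (hS : ∀ p, ∃ q, S q ∧ le₁ q p) {one : {p // S p}}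
    (h : CapturesDirectExtensions le₁ one.1) :
    CapturesDirectExtensions (fun q p : {p // S p} => le₁ q.1 p.1) one := by
  have hcompat : ∀ p q : {p // S p}, Compatible p.1 q.1 → Compatible p q := by
    rintro p q ⟨r, hrp, hrq⟩
    obtain ⟨r', hr'S, hr'⟩ := hS r
    have := le_of_le₁ _ _ hr'
    exact ⟨⟨r', hr'S⟩, this.trans hrp, this.trans hrq⟩
  intro A hA d hd
  classical
  obtain ⟨q, hq, hcap⟩ := h (Subtype.val '' A)
    (by
      rintro _ ⟨a, ha, rfl⟩ _ ⟨b, hb, rfl⟩ hne hc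
      exact hA a ha b hb (fun h => hne (h ▸ rfl)) (hcompat a b hc))
    (fun p => if hp : S p then (d ⟨p, hp⟩).1 else p)
    (by
      rintro _ ⟨a, ha, rfl⟩
      rw [dif_pos a.2]
      exact hd a ha)
  obtain ⟨q', hq'S, hq'⟩ := hS q
  refine ⟨⟨q', hq'S⟩, trans _ _ _ hq' hq, fun a ha r hr hra => hcompat _ _ ?_⟩
  have := hcap a.1 ⟨a, ha, rfl⟩ r.1 (le_trans hr (le_of_le₁ _ _ hq')) hra
  rwa [dif_pos a.2] at this

end Poset

end Forcing

namespace Magidor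

open Set Filter

/-! ### Normal ultrafilters and reflection in their ultrapowers. -/

namespace IsNormalUltrafilter

variable {κ : Ordinal.{u}} {W : Ultrafilter Ordinal.{u}}

theorem eventually_lt (hW : IsNormalUltrafilter κ W) : ∀ᶠ ξ in (W : Filter Ordinal.{u}), ξ < κ :=
  hW.mem

theorem eventually_gt (hW : IsNormalUltrafilter κ W) {μ : Ordinal.{u}} (hμ : μ < κ) :
    ∀ᶠ ξ in (W : Filter Ordinal.{u}), μ < ξ := by
  have hne : ∀ i : Ordinal.{u}, ({i}ᶜ : Set Ordinal.{u}) ∈ W := fun i =>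
    Ultrafilter.compl_mem_iff_notMem.2 (hW.nonprincipal i)
  filter_upwards [hW.complete μ hμ (fun i => {i}ᶜ) fun i _ => hne i, hne μ] with ξ hξ hξμ
  refine lt_of_not_ge fun hle => ?_
  rcases hle.lt_or_eq with hlt | heq
  · exact hξ ξ hlt rfl
  · exact hξμ heq

theorem eventually_diagonal (hW : IsNormalUltrafilter κ W) {p : Ordinal.{u} → Ordinal.{u} → Prop}
    (h : ∀ i, ∀ᶠ ξ in (W : Filter Ordinal.{u}), p i ξ) :
    ∀ᶠ ξ in (W : Filter Ordinal.{u}), ∀ i < ξ, p i ξ :=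
  hW.normal (fun i => {ξ | p i ξ}) fun i _ => h i

theorem eventually_forall_Iio (hW : IsNormalUltrafilter κ W) {α : Ordinal.{u}} (hα : α < κ)
    {p : Iio α → Ordinal.{u} → Prop} (h : ∀ i, ∀ᶠ ξ in (W : Filter Ordinal.{u}), p i ξ) :
    ∀ᶠ ξ in (W : Filter Ordinal.{u}), ∀ i, p i ξ := by
  filter_upwards [hW.complete α hα (fun i => {ξ | ∀ hi : i < α, p ⟨i, hi⟩ ξ}) fun i hi => by
    filter_upwards [h ⟨i, hi⟩] with ξ hξ _ using hξ] with ξ hξ i using hξ i i.2 i.2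

theorem eventually_forall_finset (hW : IsNormalUltrafilter κ W) {α : Ordinal.{u}} (hα : α < κ)
    {p : Finset (Iio α) → Ordinal.{u} → Prop}
    (h : ∀ i, ∀ᶠ ξ in (W : Filter Ordinal.{u}), p i ξ) :
    ∀ᶠ ξ in (W : Filter Ordinal.{u}), ∀ i, p i ξ := by
  cases finite_or_infinite (Iio α)
  · exact Filter.eventually_all.2 h
  -- An infinite `Iio α` has as many finite subsets as elements, so completeness for `α` many sets
  -- suffices.
  · obtain ⟨e⟩ := Cardinal.eq.1 (Cardinal.mk_finset_of_infinite (Iio α))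
    filter_upwards [hW.eventually_forall_Iio hα fun i => h (e.symm i)] with ξ hξ i
    simpa using hξ (e i)

/-- Pressing down: otherwise the diagonal intersection of the sets where `φ` differs from `i` would
contain a point at which `φ` is regressive. -/
theorem exists_eventually_eq (hW : IsNormalUltrafilter κ W) {φ : Ordinal.{u} → Ordinal.{u}}
    (h : ∀ᶠ ξ in (W : Filter Ordinal.{u}), φ ξ < ξ) :
    ∃ i, ∀ᶠ ξ in (W : Filter Ordinal.{u}), φ ξ = i := by
  by_contra! hne
  obtain ⟨ξ, hξ, hφ⟩ := ((hW.eventually_diagonal (p := fun i ξ => φ ξ ≠ i) hne).and h).exists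
  exact hξ (φ ξ) hφ rfl

/-- A function `ξ ↦ Y ξ ⊆ ξ` represents a subset of `κ` in the ultrapower. -/
theorem eventually_inter_Iio_eq (hW : IsNormalUltrafilter κ W)
    (Y : Ordinal.{u} → Set Ordinal.{u}) :
    ∀ᶠ ξ in (W : Filter Ordinal.{u}),
      {η | ∀ᶠ ζ in (W : Filter Ordinal.{u}), η ∈ Y ζ} ∩ Iio ξ = Y ξ ∩ Iio ξ := by
  have h : ∀ η, ∀ᶠ ξ in (W : Filter Ordinal.{u}),
      ((∀ᶠ ζ in (W : Filter Ordinal.{u}), η ∈ Y ζ) ↔ η ∈ Y ξ) := by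
    intro η
    by_cases hη : ∀ᶠ ζ in (W : Filter Ordinal.{u}), η ∈ Y ζ
    · filter_upwards [hη] with ξ hξ using iff_of_true hη hξ
    · filter_upwards [Ultrafilter.eventually_not.2 hη] with ξ hξ using iff_of_false hη hξ
  filter_upwards [hW.eventually_diagonal h] with ξ hξ
  ext η
  exact and_congr_left fun hη => hξ η hη

end IsNormalUltrafilter

namespace Represents

variable {κ : Ordinal.{u}} {W Z : Ultrafilter Ordinal.{u}}
  {h : Ordinal.{u} → Ultrafilter Ordinal.{u}}

theorem eventually_Iio_mem (hR : Represents W h Z) :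
    ∀ᶠ ξ in (W : Filter Ordinal.{u}), Iio ξ ∈ h ξ := by
  filter_upwards [(hR univ).1 univ_mem] with ξ hξ
  rwa [← univ_inter (Iio ξ)]

/-- Łoś's theorem for the predicate "belongs to `Z`": the set on the left is represented by `Y`,
since almost every `Y ξ` agrees with it below `ξ`. -/
theorem mem_iff_eventually_mem (hR : Represents W h Z) (hW : IsNormalUltrafilter κ W)
    (Y : Ordinal.{u} → Set Ordinal.{u}) :
    {η | ∀ᶠ ζ in (W : Filter Ordinal.{u}), η ∈ Y ζ} ∈ Z ↔
      ∀ᶠ ξ in (W : Filter Ordinal.{u}), Y ξ ∈ h ξ := by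
  rw [hR]
  refine eventually_congr ?_
  filter_upwards [hW.eventually_inter_Iio_eq Y, hR.eventually_Iio_mem] with ξ hξ hI
  rw [hξ]
  exact ⟨fun H => mem_of_superset H inter_subset_left, fun H => inter_mem H hI⟩

theorem eventually_nonprincipal (hR : Represents W h Z) (hW : IsNormalUltrafilter κ W)
    (hZ : IsNormalUltrafilter κ Z) :
    ∀ᶠ ξ in (W : Filter Ordinal.{u}), ∀ η : Ordinal.{u}, {η} ∉ h ξ := by
  by_contra hcon
  rw [← Ultrafilter.eventually_not] at hcon
  push Not at hcon
  obtain ⟨φ, hφ⟩ := hcon.choice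
  obtain ⟨η, hη⟩ := hW.exists_eventually_eq (φ := φ) (by
    filter_upwards [hφ, hR.eventually_Iio_mem] with ξ hξ hI
    obtain ⟨x, hx, hx'⟩ := (h ξ).nonempty_of_mem (inter_mem hξ hI)
    rwa [← mem_singleton_iff.1 hx])
  refine hZ.nonprincipal η ((hR _).2 ?_)
  filter_upwards [hφ, hη, hR.eventually_Iio_mem] with ξ hξ hξη hI
  exact inter_mem (hξη ▸ hξ) hI

/-- Counterexamples at almost all `ξ` have, by pressing down, a constant length `μ`, and they
represent a sequence of sets in `Z`. Completeness of `Z` reflects back and contradicts them. -/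
theorem eventually_complete (hR : Represents W h Z) (hW : IsNormalUltrafilter κ W)
    (hZ : IsNormalUltrafilter κ Z) :
    ∀ᶠ ξ in (W : Filter Ordinal.{u}), ∀ μ < ξ, ∀ X : Ordinal.{u} → Set Ordinal.{u},
      (∀ i < μ, X i ∈ h ξ) → {η | ∀ i < μ, η ∈ X i} ∈ h ξ := by
  by_contra hcon
  rw [← Ultrafilter.eventually_not] at hcon
  push Not at hcon
  obtain ⟨φ, hφ⟩ := hcon.choice
  obtain ⟨μ, hμ⟩ := hW.exists_eventually_eq (φ := φ) (hφ.mono fun _ H => H.1)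
  obtain ⟨X, hX⟩ := (hφ.mono fun _ H => H.2).choice
  have hμκ : μ < κ := by
    obtain ⟨ξ, h1, h2, h3⟩ := (hμ.and (hφ.and hW.eventually_lt)).exists
    exact h1 ▸ h2.1.trans h3
  have hmem := hZ.complete μ hμκ
    (fun i => {η | ∀ᶠ ζ in (W : Filter Ordinal.{u}), η ∈ X ζ i}) fun i hi => by
      rw [hR.mem_iff_eventually_mem hW fun ζ => X ζ i]
      filter_upwards [hX, hμ] with ξ hξ hξμ using hξ.1 i (hξμ ▸ hi)
  replace hmem := Filter.eventually_mem_set.2 ((hR _).1 hmem)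
  obtain ⟨ξ, hξ, hξμ, hξX, hφξ, hd⟩ := (hmem.and (hμ.and (hX.and (hφ.and
    (hW.eventually_diagonal fun i => hW.eventually_inter_Iio_eq fun ζ => X ζ i))))).exists
  refine hξX.2 (mem_of_superset hξ ?_)
  rintro η ⟨hη, hηξ⟩ i hi
  have := (hd i (hi.trans hφξ.1)).subset ⟨hη i (hξμ ▸ hi), hηξ⟩
  exact this.1

theorem eventually_normal (hR : Represents W h Z) (hW : IsNormalUltrafilter κ W)
    (hZ : IsNormalUltrafilter κ Z) :
    ∀ᶠ ξ in (W : Filter Ordinal.{u}), ∀ X : Ordinal.{u} → Set Ordinal.{u},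
      (∀ i < ξ, X i ∈ h ξ) → {η | ∀ i < η, η ∈ X i} ∈ h ξ := by
  by_contra hcon
  rw [← Ultrafilter.eventually_not] at hcon
  push Not at hcon
  obtain ⟨X, hX⟩ := hcon.choice
  have hmem := hZ.normal
    (fun i => {η | ∀ᶠ ζ in (W : Filter Ordinal.{u}), η ∈ X ζ i}) fun i hi => by
      rw [hR.mem_iff_eventually_mem hW fun ζ => X ζ i]
      filter_upwards [hX, hW.eventually_gt hi] with ξ hξ hξi using hξ.1 i hξi
  replace hmem := Filter.eventually_mem_set.2 ((hR _).1 hmem)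
  obtain ⟨ξ, hξ, hξX, hd⟩ := (hmem.and (hX.and
    (hW.eventually_diagonal fun i => hW.eventually_inter_Iio_eq fun ζ => X ζ i))).exists
  refine hξX.2 (mem_of_superset hξ ?_)
  rintro η ⟨hη, hηξ⟩ i hi
  exact ((hd i (hi.trans hηξ)).subset ⟨hη i hi, hηξ⟩).1

theorem eventually_isNormalUltrafilter (hR : Represents W h Z) (hW : IsNormalUltrafilter κ W)
    (hZ : IsNormalUltrafilter κ Z) :
    ∀ᶠ ξ in (W : Filter Ordinal.{u}), IsNormalUltrafilter ξ (h ξ) := by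
  filter_upwards [hR.eventually_Iio_mem, hR.eventually_nonprincipal hW hZ,
    hR.eventually_complete hW hZ, hR.eventually_normal hW hZ] with ξ h1 h2 h3 h4
    using ⟨h1, h2, h3, h4⟩

/-- Counterexamples `X ξ` represent a single subset of `κ`. Its membership in `Z` can be computed
directly or through `V`, and both computations reflect to almost all `ξ`. -/
theorem eventually_represents {V : Ultrafilter Ordinal.{u}}
    {h' k : Ordinal.{u} → Ultrafilter Ordinal.{u}} (hW : IsNormalUltrafilter κ W)
    (hWZ : Represents W h Z) (hWV : Represents W h' V) (hVZ : Represents V k Z) :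
    ∀ᶠ ξ in (W : Filter Ordinal.{u}), Represents (h' ξ) k (h ξ) := by
  by_contra hcon
  rw [← Ultrafilter.eventually_not] at hcon
  simp only [Represents, not_forall] at hcon
  obtain ⟨X, hX⟩ := hcon.choice
  have h1 := hWZ.mem_iff_eventually_mem hW X
  have h2 : {η | ∀ᶠ ζ in (W : Filter Ordinal.{u}), η ∈ X ζ} ∈ Z ↔
      ∀ᶠ ξ in (W : Filter Ordinal.{u}), {ζ | X ξ ∩ Iio ζ ∈ k ζ} ∈ h' ξ := by
    rw [hVZ, hWV]
    refine eventually_congr ?_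
    filter_upwards [hW.eventually_inter_Iio_eq X, hWV.eventually_Iio_mem] with ξ hξ hI
    have hkey : ∀ ζ < ξ, {η | ∀ᶠ ζ in (W : Filter Ordinal.{u}), η ∈ X ζ} ∩ Iio ζ =
        X ξ ∩ Iio ζ := by
      intro ζ hζ
      rw [← inter_eq_self_of_subset_right (Iio_subset_Iio hζ.le), ← inter_assoc, hξ, inter_assoc]
    constructor
    · intro H
      filter_upwards [H] with ζ hζ
      have := hζ.1
      rwa [mem_ofPred_eq, hkey ζ hζ.2] at this
    · intro H
      filter_upwards [H, hI] with ζ hζ hζξ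
      refine ⟨?_, hζξ⟩
      rwa [mem_ofPred_eq, hkey ζ hζξ]
  by_cases hmem : {η | ∀ᶠ ζ in (W : Filter Ordinal.{u}), η ∈ X ζ} ∈ Z
  · obtain ⟨ξ, hξ, a, b⟩ := (hX.and ((h1.1 hmem).and (h2.1 hmem))).exists
    exact hξ (iff_of_true a b)
  · obtain ⟨ξ, hξ, a, b⟩ := (hX.and ((Ultrafilter.eventually_not.2 (mt h1.2 hmem)).and
      (Ultrafilter.eventually_not.2 (mt h2.2 hmem)))).exists
    exact hξ (iff_of_false a b)

end Represents

/-- Almost all points reflect a system of normal ultrafilters that is coherent below `δ`. -/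
theorem goodSet_mem {κ α : Ordinal.{u}} (hα : α < κ)
    {f : Iio α → Iio α → Ordinal.{u} → Ultrafilter Ordinal.{u}}
    {W : Iio α → Ultrafilter Ordinal.{u}} {δ : Iio α}
    (hW : ∀ β ≤ δ, IsNormalUltrafilter κ (W β))
    (hR : ∀ β η, β < η → η ≤ δ → Represents (W η) (f η β) (W β)) :
    goodSet κ α f δ ∈ W δ := by
  have hδ := hW δ le_rfl
  have h1 : ∀ᶠ ξ in (W δ : Filter Ordinal.{u}), ∀ β, β < δ → IsNormalUltrafilter ξ (f δ β ξ) :=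
    hδ.eventually_forall_Iio hα fun β => by
      by_cases hβ : β < δ
      · filter_upwards [(hR β δ hβ le_rfl).eventually_isNormalUltrafilter hδ (hW β hβ.le)]
          with ξ hξ _ using hξ
      · exact .of_forall fun _ h => (hβ h).elim
  have h2 : ∀ᶠ ξ in (W δ : Filter Ordinal.{u}), ∀ β η, β < η → η < δ →
      Represents (f δ η ξ) (f η β) (f δ β ξ) :=
    hδ.eventually_forall_Iio hα fun β => hδ.eventually_forall_Iio hα fun η => by
      by_cases h : β < η ∧ η < δ
      · filter_upwards [Represents.eventually_represents hδ (hR β δ (h.1.trans h.2) le_rfl)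
          (hR η δ h.2 le_rfl) (hR β η h.1 h.2.le)] with ξ hξ _ _ using hξ
      · exact .of_forall fun _ h1 h2 => (h ⟨h1, h2⟩).elim
  filter_upwards [hδ.eventually_gt hα, hδ.eventually_lt, h1, h2] with ξ a b c d
    using ⟨a, b, c, d⟩

/-- The measures `f γ β ξ` with `β < γ` form a coherent system on `ξ`, so `goodSet_mem` applies with
`ξ` in the role of `κ`. -/
theorem goodSet_inter_Iio_mem {κ α : Ordinal.{u}}
    {f : Iio α → Iio α → Ordinal.{u} → Ultrafilter Ordinal.{u}} {γ δ : Iio α} (hδ : δ < γ)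
    {ξ : Ordinal.{u}} (hξ : ξ ∈ goodSet κ α f γ) : goodSet κ α f δ ∩ Iio ξ ∈ f γ δ ξ := by
  obtain ⟨h1, h2, h3, h4⟩ := hξ
  refine mem_of_superset (goodSet_mem h1 (W := fun β => f γ β ξ) (f := f)
    (fun β hβ => h3 β (hβ.trans_lt hδ)) fun β η hβ hη => h4 β η hβ (hη.trans_lt hδ)) ?_
  rintro ζ ⟨k1, k2, k3⟩
  exact ⟨⟨k1, k2.trans h2, k3⟩, k2⟩

/-- Homogeneity for increasing sequences with respect to a product of normal ultrafilters. -/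
theorem exists_homogeneous {α : Ordinal.{u}} {κ : Iio α → Ordinal.{u}}
    {W : Iio α → Ultrafilter Ordinal.{u}} (l : List (Iio α)) (hl : l.Pairwise (· < ·))
    (hW : ∀ γ ∈ l, IsNormalUltrafilter (κ γ) (W γ)) (R : (Iio α → Ordinal.{u}) → Prop)
    (g : Iio α → Ordinal.{u}) :
    ∃ (X : Iio α → Set Ordinal.{u}) (c : Prop), (∀ γ ∈ l, X γ ∈ W γ) ∧
      ∀ h : Iio α → Ordinal.{u}, (∀ γ ∉ l, h γ = g γ) → (∀ γ ∈ l, h γ ∈ X γ) →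
        (∀ β ∈ l, ∀ γ ∈ l, β < γ → h β < h γ) → (R h ↔ c) := by
  classical
  induction l generalizing g with
  | nil =>
    refine ⟨fun _ => univ, R g, by simp, fun h hh _ _ => ?_⟩
    rw [show h = g from funext fun γ => hh γ (by simp)]
  | cons δ l ih =>
    rw [List.pairwise_cons] at hl
    have hδ : δ ∉ l := fun h => (hl.1 δ h).false
    -- Fix the value `ξ` at the least index `δ` and apply the induction hypothesis to the remaining
    -- ones. The outcome `c ξ` is constant for almost all `ξ`, and the sets `X ξ γ` are intersected
    -- diagonally, which suffices because later values exceed the one at `δ`.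
    choose X c hX hc using fun ξ =>
      ih hl.2 (fun γ hγ => hW γ (List.mem_cons_of_mem _ hγ)) (Function.update g δ ξ)
    obtain ⟨d, hd⟩ : ∃ d : Prop, ∀ᶠ ξ in (W δ : Filter Ordinal.{u}), c ξ ↔ d := by
      by_cases h : ∀ᶠ ξ in (W δ : Filter Ordinal.{u}), c ξ
      · exact ⟨True, h.mono fun ξ hξ => iff_true_intro hξ⟩
      · exact ⟨False, (Ultrafilter.eventually_not.2 h).mono fun ξ hξ => iff_false_intro hξ⟩
    refine ⟨fun γ => if γ = δ then {ξ | c ξ ↔ d} else {ζ | ∀ ξ < ζ, ζ ∈ X ξ γ}, d, ?_, ?_⟩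
    · intro γ hγ
      rcases List.mem_cons.1 hγ with rfl | hγ'
      · simp only [if_pos]
        exact hd
      · simp only [if_neg (ne_of_mem_of_not_mem hγ' hδ)]
        exact (hW γ hγ).eventually_diagonal fun ξ => hX ξ γ hγ'
    · intro h h1 h2 h3
      have hmem := h2 δ List.mem_cons_self
      simp only [if_pos] at hmem
      rw [← show c (h δ) ↔ d from hmem]
      refine hc (h δ) h (fun γ hγ => ?_) (fun γ hγ => ?_) fun β hβ γ hγ =>
        h3 β (List.mem_cons_of_mem _ hβ) γ (List.mem_cons_of_mem _ hγ)
      · by_cases hγδ : γ = δ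
        · subst hγδ
          simp
        · rw [Function.update_of_ne hγδ]
          exact h1 γ (by simp [hγδ, hγ])
      · have := h2 γ (List.mem_cons_of_mem _ hγ)
        simp only [if_neg (ne_of_mem_of_not_mem hγ hδ)] at this
        exact this _ (h3 δ List.mem_cons_self γ (List.mem_cons_of_mem _ hγ) (hl.1 γ hγ))

/-! ### Stems, their measures, and extensions by new points. -/

namespace Condition

variable {κ α : Ordinal.{u}} {U : Iio α → Ultrafilter Ordinal.{u}}
  {f : Iio α → Iio α → Ordinal.{u} → Ultrafilter Ordinal.{u}}

theorem DirectLE.refl (p : Condition κ α U f) : p.DirectLE p := ⟨le_rfl, rfl, rfl⟩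

theorem DirectLE.trans {p q r : Condition κ α U f} (hrq : r.DirectLE q) (hqp : q.DirectLE p) :
    r.DirectLE p :=
  ⟨hrq.1.trans hqp.1, hrq.2.1.trans hqp.2.1, hrq.2.2.trans hqp.2.2⟩

theorem DirectLE.connected {p q q' : Condition κ α U f} (hqp : q.DirectLE p) (hqq' : q ≤ q')
    (hq'p : q' ≤ p) : q'.DirectLE p := by
  have hd : q'.dom = p.dom := (hqp.2.1 ▸ hqq'.1).antisymm hq'p.1
  refine ⟨hq'p, hd, funext fun γ => ?_⟩
  by_cases hγ : γ ∈ p.dom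
  · exact hq'p.2.1 γ hγ
  · rw [p.g_dummy γ hγ, q'.g_dummy γ (hd ▸ hγ)]

/-- The least element above `γ` of the domain of the stem of a condition. -/
noncomputable def next (p : Condition κ α U f) (γ : Iio α) : WithTop (Iio α) :=
  (p.dom.filter (γ < ·)).min

/-- The ordinal on which `p.measure γ` lives. -/
noncomputable def bound (p : Condition κ α U f) (γ : Iio α) : Ordinal.{u} :=
  WithTop.recTopCoe κ p.g (p.next γ)

/-- The ultrafilter to which `p.G γ` belongs. -/
noncomputable def measure (p : Condition κ α U f) (γ : Iio α) : Ultrafilter Ordinal.{u} :=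
  WithTop.recTopCoe (U γ) (fun ρ => f ρ γ (p.g ρ)) (p.next γ)

theorem next_eq_top {p : Condition κ α U f} {γ : Iio α} :
    p.next γ = ⊤ ↔ ∀ β ∈ p.dom, β ≤ γ := by
  simp [next, Finset.min_eq_top, Finset.filter_eq_empty_iff]

theorem next_eq_coe {p : Condition κ α U f} {γ ρ : Iio α} :
    p.next γ = ρ ↔ ρ ∈ p.dom ∧ γ < ρ ∧ ∀ β ∈ p.dom, γ < β → ρ ≤ β := by
  constructor
  · intro h
    have h1 := Finset.mem_filter.1 (Finset.mem_of_min h)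
    exact ⟨h1.1, h1.2, fun β hβ hγβ => Finset.min_le_of_eq (Finset.mem_filter.2 ⟨hβ, hγβ⟩) h⟩
  · rintro ⟨h1, h2, h3⟩
    refine le_antisymm (Finset.min_le (Finset.mem_filter.2 ⟨h1, h2⟩)) (Finset.le_min fun β hβ => ?_)
    exact WithTop.coe_le_coe.2 (h3 β (Finset.mem_filter.1 hβ).1 (Finset.mem_filter.1 hβ).2)

theorem measure_of_next_eq_top {p : Condition κ α U f} {γ : Iio α} (h : p.next γ = ⊤) :
    p.measure γ = U γ := by
  simp [measure, h]

theorem measure_of_next_eq_coe {p : Condition κ α U f} {γ ρ : Iio α} (h : p.next γ = ρ) :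
    p.measure γ = f ρ γ (p.g ρ) := by
  simp [measure, h]

theorem bound_of_next_eq_top {p : Condition κ α U f} {γ : Iio α} (h : p.next γ = ⊤) :
    p.bound γ = κ := by
  simp [bound, h]

theorem bound_of_next_eq_coe {p : Condition κ α U f} {γ ρ : Iio α} (h : p.next γ = ρ) :
    p.bound γ = p.g ρ := by
  simp [bound, h]

theorem G_mem_measure (p : Condition κ α U f) {γ : Iio α} (hγ : γ ∉ p.dom) :
    p.G γ ∈ p.measure γ := by
  cases h : p.next γ with
  | top =>
    rw [measure_of_next_eq_top h]
    exact p.G_mem_top γ hγ fun β hβ =>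
      (next_eq_top.1 h β hβ).lt_of_ne fun hne => hγ (hne ▸ hβ)
  | coe ρ =>
    rw [measure_of_next_eq_coe h]
    obtain ⟨h1, h2, h3⟩ := next_eq_coe.1 h
    exact p.G_mem γ hγ ρ h1 h2 h3

section System

variable (hUf : IsMagidorSystem κ α U f)
include hUf

theorem isNormalUltrafilter_measure (p : Condition κ α U f) (γ : Iio α) :
    IsNormalUltrafilter (p.bound γ) (p.measure γ) := by
  cases h : p.next γ with
  | top =>
    rw [measure_of_next_eq_top h, bound_of_next_eq_top h]
    exact hUf.normal γ
  | coe ρ =>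
    rw [measure_of_next_eq_coe h, bound_of_next_eq_coe h]
    obtain ⟨h1, h2, -⟩ := next_eq_coe.1 h
    exact (p.g_mem ρ h1).2.2.1 γ h2

theorem lt_bound (p : Condition κ α U f) (γ : Iio α) : α < p.bound γ := by
  cases h : p.next γ with
  | top =>
    rw [bound_of_next_eq_top h]
    exact hUf.lt
  | coe ρ =>
    rw [bound_of_next_eq_coe h]
    exact (p.g_mem ρ (next_eq_coe.1 h).1).1

/-- With no stem index in `[δ, γ]`, both indices have the same next stem index `ρ`. Coherence then
holds by assumption if there is none, and by reflection at `p.g ρ` otherwise. -/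
theorem represents_measure (p : Condition κ α U f) {δ γ : Iio α} (hδγ : δ < γ)
    (h : ∀ β ∈ p.dom, ¬ (δ ≤ β ∧ β ≤ γ)) :
    Represents (p.measure γ) (f γ δ) (p.measure δ) := by
  have hnext : p.next δ = p.next γ := by
    refine congrArg Finset.min (Finset.filter_congr fun β hβ => ⟨fun hlt => ?_, hδγ.trans⟩)
    exact lt_of_not_ge fun hle => h β hβ ⟨hlt.le, hle⟩
  cases hγ : p.next γ with
  | top =>
    rw [measure_of_next_eq_top hγ, measure_of_next_eq_top (hnext.trans hγ)]
    exact hUf.represents δ γ hδγ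
  | coe ρ =>
    rw [measure_of_next_eq_coe hγ, measure_of_next_eq_coe (hnext.trans hγ)]
    obtain ⟨h1, h2, -⟩ := next_eq_coe.1 hγ
    exact (p.g_mem ρ h1).2.2.2 δ γ hδγ h2

end System

theorem measure_congr {p q : Condition κ α U f} (hd : q.dom = p.dom) (hg : q.g = p.g)
    (γ : Iio α) : q.measure γ = p.measure γ := by
  simp only [measure, next, hd, hg]

/-- The direct extension obtained by intersecting the sets `p.G γ` with sets of measure one. -/
def restrict (p : Condition κ α U f) (X : Iio α → Set Ordinal.{u})
    (hX : ∀ γ ∉ p.dom, X γ ∈ p.measure γ) : Condition κ α U f where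
  dom := p.dom
  g := p.g
  G γ := p.G γ ∩ X γ
  g_dummy := p.g_dummy
  G_dummy γ hγ := by rw [p.G_dummy γ hγ, empty_inter]
  g_mem := p.g_mem
  g_strictMono := p.g_strictMono
  G_subset γ hγ := inter_subset_left.trans (p.G_subset γ hγ)
  G_mem_top γ hγ h := by
    rw [← measure_of_next_eq_top (next_eq_top.2 fun β hβ => (h β hβ).le)]
    exact inter_mem (p.G_mem_measure hγ) (hX γ hγ)
  G_mem γ hγ ρ hρ hlt hmin := by
    rw [← measure_of_next_eq_coe (next_eq_coe.2 ⟨hρ, hlt, hmin⟩)]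
    exact inter_mem (p.G_mem_measure hγ) (hX γ hγ)
  lt_of_mem_G γ hγ β hβ h ξ hξ := p.lt_of_mem_G γ hγ β hβ h ξ hξ.1
  mem_G_lt γ hγ β hβ h ξ hξ := p.mem_G_lt γ hγ β hβ h ξ hξ.1

theorem restrict_directLE (p : Condition κ α U f) (X : Iio α → Set Ordinal.{u})
    (hX : ∀ γ ∉ p.dom, X γ ∈ p.measure γ) : (p.restrict X hX).DirectLE p :=
  ⟨⟨subset_rfl, fun _ _ => rfl, fun _ h h' => (h' h).elim, fun _ _ => inter_subset_left⟩, rfl, rfl⟩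

/-- Conditions with the same stem have a common direct extension. -/
theorem exists_directLE_directLE {p q : Condition κ α U f} (hd : q.dom = p.dom)
    (hg : q.g = p.g) : ∃ r : Condition κ α U f, r.DirectLE p ∧ r.DirectLE q := by
  have hq : ∀ γ ∉ p.dom, q.G γ ∈ p.measure γ := fun γ hγ =>
    measure_congr hd hg γ ▸ q.G_mem_measure (hd ▸ hγ)
  refine ⟨p.restrict q.G hq, p.restrict_directLE _ _, ⟨hd.subset, fun γ _ => congrFun hg.symm γ,
    fun γ h h' => (h' (hd ▸ h)).elim, fun _ _ => inter_subset_right⟩, hd.symm, hg.symm⟩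

/-- A point of `p.G γ` can be added to the stem of `p` at `γ`, provided that the sets `p.G δ`
reflect to it. -/
theorem exists_le_insert (hUf : IsMagidorSystem κ α U f) (p : Condition κ α U f) {γ : Iio α}
    (hγ : γ ∉ p.dom) {ξ : Ordinal.{u}} (hξ : ξ ∈ p.G γ)
    (h : ∀ δ < γ, (∀ β ∈ p.dom, ¬ (δ ≤ β ∧ β ≤ γ)) → p.G δ ∩ Iio ξ ∈ f γ δ ξ) :
    ∃ r ≤ p, r.dom = insert γ p.dom ∧ r.g γ = ξ := by
  have hne : ∀ β ∈ p.dom, β ≠ γ := fun β hβ => ne_of_mem_of_not_mem hβ hγ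
  have hg : ∀ β ∈ p.dom, Function.update p.g γ ξ β = p.g β := fun β hβ =>
    Function.update_of_ne (hne β hβ) _ _
  have hlt : ∀ β ∈ p.dom, β < γ → p.g β < ξ := fun β hβ hβγ => p.lt_of_mem_G γ hγ β hβ hβγ ξ hξ
  have hgt : ∀ β ∈ p.dom, γ < β → ξ < p.g β := fun β hβ hγβ => p.mem_G_lt γ hγ β hβ hγβ ξ hξ
  have hIoi : ∀ δ, γ < δ → δ ∉ p.dom → ∀ᶠ ζ in (p.measure δ : Filter Ordinal.{u}), ξ < ζ := by
    intro δ hγδ hδ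
    refine (p.isNormalUltrafilter_measure hUf δ).eventually_gt ?_
    cases hn : p.next δ with
    | top =>
      rw [bound_of_next_eq_top hn]
      exact (p.G_subset γ hγ hξ).2.1
    | coe ρ =>
      rw [bound_of_next_eq_coe hn]
      obtain ⟨h1, h2, -⟩ := next_eq_coe.1 hn
      exact hgt ρ h1 (hγδ.trans h2)
  refine ⟨{
    dom := insert γ p.dom
    g := Function.update p.g γ ξ
    G := fun δ => {ζ ∈ p.G δ | δ ≠ γ ∧ (δ < γ → ζ < ξ) ∧ (γ < δ → ξ < ζ)}
    g_dummy := ?_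
    G_dummy := ?_
    g_mem := ?_
    g_strictMono := ?_
    G_subset := ?_
    G_mem_top := ?_
    G_mem := ?_
    lt_of_mem_G := ?_
    mem_G_lt := ?_ }, ⟨?_, ?_, ?_, ?_⟩, rfl, ?_⟩
  · intro δ hδ
    rw [Finset.mem_insert, not_or] at hδ
    rw [Function.update_of_ne hδ.1, p.g_dummy δ hδ.2]
  · intro δ hδ
    rcases Finset.mem_insert.1 hδ with rfl | hδ
    · exact eq_empty_of_forall_notMem fun ζ hζ => hζ.2.1 rfl
    · exact eq_empty_of_forall_notMem fun ζ hζ => by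
        have := hζ.1
        rwa [p.G_dummy δ hδ] at this
  · intro δ hδ
    rcases Finset.mem_insert.1 hδ with rfl | hδ
    · rw [Function.update_self]
      exact p.G_subset _ hγ hξ
    · rw [hg δ hδ]
      exact p.g_mem δ hδ
  · intro β hβ δ hδ hβδ
    rcases Finset.mem_insert.1 hβ with hβ | hβ <;> rcases Finset.mem_insert.1 hδ with hδ | hδ
    · exact ((hβ.trans hδ.symm).not_lt hβδ).elim
    · rw [hg δ hδ, hβ, Function.update_self]
      exact hgt δ hδ (hβ ▸ hβδ)
    · rw [hg β hβ, hδ, Function.update_self]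
      exact hlt β hβ (hδ ▸ hβδ)
    · rw [hg β hβ, hg δ hδ]
      exact p.g_strictMono β hβ δ hδ hβδ
  · intro δ hδ
    rw [Finset.mem_insert, not_or] at hδ
    exact (sep_subset _ _).trans (p.G_subset δ hδ.2)
  · intro δ hδ hmax
    rw [Finset.mem_insert, not_or] at hδ
    have hγδ := hmax γ (Finset.mem_insert_self _ _)
    rw [← measure_of_next_eq_top (p := p)
      (next_eq_top.2 fun β hβ => (hmax β (Finset.mem_insert_of_mem hβ)).le)]
    filter_upwards [p.G_mem_measure hδ.2, hIoi δ hγδ hδ.2] with ζ h1 h2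
    exact ⟨h1, hδ.1, fun h' => (h'.asymm hγδ).elim, fun _ => h2⟩
  · intro δ hδ ρ hρ hδρ hmin
    rw [Finset.mem_insert, not_or] at hδ
    -- Only indices whose next stem index has become `γ` get a new measure, and for these the
    -- reflection hypothesis `h` is needed. All other measures are unchanged.
    rcases Finset.mem_insert.1 hρ with rfl | hρ
    · rw [Function.update_self]
      refine mem_of_superset (h δ hδρ fun β hβ hδβ => ?_) ?_
      · have hlt' : δ < β := hδβ.1.lt_of_ne fun he => hδ.2 (he ▸ hβ)
        exact hne β hβ (hδβ.2.antisymm (hmin β (Finset.mem_insert_of_mem hβ) hlt'))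
      · rintro ζ ⟨h1, h2⟩
        exact ⟨h1, hδ.1, fun _ => h2, fun h' => (h'.asymm hδρ).elim⟩
    · rw [hg ρ hρ, ← measure_of_next_eq_coe (p := p)
        (next_eq_coe.2 ⟨hρ, hδρ, fun β hβ => hmin β (Finset.mem_insert_of_mem hβ)⟩)]
      rcases lt_or_gt_of_ne hδ.1 with hδγ | hγδ
      · have hργ : ρ < γ := (hmin γ (Finset.mem_insert_self _ _) hδγ).lt_of_ne (hne ρ hρ)
        filter_upwards [p.G_mem_measure hδ.2] with ζ h1
        exact ⟨h1, hδ.1, fun _ => (p.mem_G_lt δ hδ.2 ρ hρ hδρ ζ h1).trans (hlt ρ hρ hργ),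
          fun h' => (h'.asymm hδγ).elim⟩
      · filter_upwards [p.G_mem_measure hδ.2, hIoi δ hγδ hδ.2] with ζ h1 h2
        exact ⟨h1, hδ.1, fun h' => (h'.asymm hγδ).elim, fun _ => h2⟩
  · intro δ hδ β hβ hβδ ζ hζ
    rw [Finset.mem_insert, not_or] at hδ
    rcases Finset.mem_insert.1 hβ with rfl | hβ
    · rw [Function.update_self]
      exact hζ.2.2.2 hβδ
    · rw [hg β hβ]
      exact p.lt_of_mem_G δ hδ.2 β hβ hβδ ζ hζ.1
  · intro δ hδ β hβ hδβ ζ hζ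
    rw [Finset.mem_insert, not_or] at hδ
    rcases Finset.mem_insert.1 hβ with rfl | hβ
    · rw [Function.update_self]
      exact hζ.2.2.1 hδβ
    · rw [hg β hβ]
      exact p.mem_G_lt δ hδ.2 β hβ hδβ ζ hζ.1
  · exact Finset.subset_insert _ _
  · exact hg
  · intro δ hδ hδp
    obtain rfl := (Finset.mem_insert.1 hδ).resolve_right hδp
    change Function.update p.g δ ξ δ ∈ p.G δ
    rwa [Function.update_self]
  · exact fun δ _ => sep_subset _ _
  · exact Function.update_self _ _ _

section System

variable (hUf : IsMagidorSystem κ α U f)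
include hUf

/-- By coherence each single `p.G δ` reflects to almost all points of `p.G γ`, and by completeness
all of them reflect simultaneously. -/
theorem exists_le_dom_eq_insert (p : Condition κ α U f) (γ : Iio α) :
    ∃ r ≤ p, r.dom = insert γ p.dom := by
  by_cases hγ : γ ∈ p.dom
  · exact ⟨p, le_rfl, (Finset.insert_eq_of_mem hγ).symm⟩
  have hall : ∀ᶠ ξ in (p.measure γ : Filter Ordinal.{u}), ∀ δ, δ < γ →
      (∀ β ∈ p.dom, ¬ (δ ≤ β ∧ β ≤ γ)) → p.G δ ∩ Iio ξ ∈ f γ δ ξ :=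
    (p.isNormalUltrafilter_measure hUf γ).eventually_forall_Iio (p.lt_bound hUf γ) fun δ => by
      by_cases h : δ < γ ∧ ∀ β ∈ p.dom, ¬ (δ ≤ β ∧ β ≤ γ)
      · have hδ : δ ∉ p.dom := fun hδ => h.2 δ hδ ⟨le_rfl, h.1.le⟩
        filter_upwards [(p.represents_measure hUf h.1 h.2 _).1 (p.G_mem_measure hδ)]
          with ξ hξ _ _ using hξ
      · exact .of_forall fun _ h1 h2 => (h ⟨h1, h2⟩).elim
  obtain ⟨ξ, hξ, hξG⟩ := (hall.and (Filter.eventually_mem_set.2 (p.G_mem_measure hγ))).exists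
  obtain ⟨r, hr, hrd, -⟩ := p.exists_le_insert hUf hγ hξG hξ
  exact ⟨r, hr, hrd⟩

theorem exists_le_dom_eq_union (p : Condition κ α U f) (E : Finset (Iio α)) :
    ∃ r ≤ p, r.dom = E ∪ p.dom := by
  induction E using Finset.induction_on with
  | empty => exact ⟨p, le_rfl, by simp⟩
  | insert γ E _ ih =>
    obtain ⟨r, hr, hrd⟩ := ih
    obtain ⟨r', hr', hr'd⟩ := r.exists_le_dom_eq_insert hUf γ
    exact ⟨r', hr'.trans hr, by rw [hr'd, hrd, Finset.insert_union]⟩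

/-- Every family of properties of stems becomes homogeneous below a direct extension: on
restrictions of stems to a given domain, its members are constant. -/
theorem exists_directLE_homogeneous (p : Condition κ α U f)
    (R : Iio α → Finset (Iio α) → (Iio α → Ordinal.{u}) → Prop) :
    ∃ q : Condition κ α U f, q.DirectLE p ∧ ∀ γ E, p.dom ⊆ E → ∃ c : Prop, ∀ r ≤ q, E ⊆ r.dom →
      (R γ E (E.piecewise r.g 0) ↔ c) := by
  choose X c hX hc using fun γ E => exists_homogeneous (κ := p.bound) (W := p.measure)
    ((E \ p.dom).sort (· ≤ ·)) (Finset.sortedLT_sort _).pairwise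
    (fun δ _ => p.isNormalUltrafilter_measure hUf δ) (R γ E) p.g
  -- Every measure lives on an ordinal above `α`, so the homogeneous sets for all `γ` and all finite
  -- `E` can be intersected.
  have hY : ∀ δ ∉ p.dom, {ξ | ∀ γ E, δ ∈ E → ξ ∈ X γ E δ} ∈ p.measure δ := fun δ hδ =>
    (p.isNormalUltrafilter_measure hUf δ).eventually_forall_Iio (p.lt_bound hUf δ) fun γ =>
      (p.isNormalUltrafilter_measure hUf δ).eventually_forall_finset (p.lt_bound hUf δ) fun E => by
        by_cases hE : δ ∈ E
        · filter_upwards [hX γ E δ (by simp [hE, hδ])] with ξ hξ _ using hξ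
        · exact .of_forall fun _ h => (hE h).elim
  have hq := p.restrict_directLE _ hY
  refine ⟨_, hq, fun γ E hpE => ⟨c γ E, fun r hr hrE => ?_⟩⟩
  have hrp := hr.trans hq.1
  refine hc γ E _ (fun δ hδ => ?_) (fun δ hδ => ?_) fun β hβ δ hδ hlt => ?_
  · rw [Finset.mem_sort, Finset.mem_sdiff] at hδ
    by_cases hδE : δ ∈ E
    · rw [Finset.piecewise_eq_of_mem _ _ _ hδE]
      exact hrp.2.1 δ (by_contra fun hδp => hδ ⟨hδE, hδp⟩)
    · rw [Finset.piecewise_eq_of_notMem _ _ _ hδE, p.g_dummy δ fun hδp => hδE (hpE hδp)]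
      rfl
  · rw [Finset.mem_sort, Finset.mem_sdiff] at hδ
    rw [Finset.piecewise_eq_of_mem _ _ _ hδ.1]
    exact (hr.2.2.1 δ (hrE hδ.1) hδ.2).2 γ E hδ.1
  · rw [Finset.mem_sort, Finset.mem_sdiff] at hβ hδ
    rw [Finset.piecewise_eq_of_mem _ _ _ hβ.1, Finset.piecewise_eq_of_mem _ _ _ hδ.1]
    exact r.g_strictMono β (hrE hβ.1) δ (hrE hδ.1) hlt

end System

/-! ### The Prikry property. -/

theorem piecewise_dom_g (p : Condition κ α U f) : p.dom.piecewise p.g 0 = p.g := by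
  ext1 γ
  by_cases hγ : γ ∈ p.dom
  · rw [Finset.piecewise_eq_of_mem _ _ _ hγ]
  · rw [Finset.piecewise_eq_of_notMem _ _ _ hγ, p.g_dummy γ hγ]
    rfl

theorem g_eq_of_eqOn_dom {p q : Condition κ α U f} (hd : q.dom = p.dom)
    (h : ∀ γ ∈ p.dom, q.g γ = p.g γ) : q.g = p.g := by
  ext1 γ
  by_cases hγ : γ ∈ p.dom
  · exact h γ hγ
  · rw [p.g_dummy γ hγ, q.g_dummy γ (hd ▸ hγ)]

theorem openPrikryProperty (hUf : IsMagidorSystem κ α U f) :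
    Forcing.OpenPrikryProperty (DirectLE (κ := κ) (α := α) (U := U) (f := f)) := by
  intro b p
  by_cases hα : Nonempty (Iio α)
  swap
  · refine ⟨p, DirectLE.refl p, ?_⟩
    have hle : ∀ q r : Condition κ α U f, q ≤ r := fun q r =>
      ⟨fun γ => (hα ⟨γ⟩).elim, fun γ => (hα ⟨γ⟩).elim, fun γ => (hα ⟨γ⟩).elim,
        fun γ => (hα ⟨γ⟩).elim⟩
    by_cases hp : p ∈ b
    · exact Or.inr fun r hr => ⟨r, le_rfl, b.lower hr hp⟩
    · exact Or.inl fun r _ hrb => hp (b.lower (hle p r) hrb)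
  obtain ⟨γ⟩ := hα
  -- A single property suffices here, so the index `γ` of the family is a dummy; this is why `α = 0`
  -- was treated separately.
  obtain ⟨q, hq, hom⟩ := p.exists_directLE_homogeneous hUf fun _ E g =>
    ∃ r ∈ b, r.dom = E ∧ r.g = g
  refine ⟨q, hq, or_iff_not_imp_left.2 fun hcon r₁ hr₁ => ?_⟩
  push Not at hcon
  obtain ⟨r₀, hr₀, hr₀b⟩ := hcon
  obtain ⟨s₀, hs₀, hs₀d⟩ := r₀.exists_le_dom_eq_union hUf r₁.dom
  obtain ⟨s₁, hs₁, hs₁d⟩ := r₁.exists_le_dom_eq_union hUf r₀.dom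
  have hd : s₁.dom = s₀.dom := by rw [hs₁d, hs₀d, Finset.union_comm]
  obtain ⟨c, hc⟩ := hom γ s₀.dom ((hs₀.trans hr₀).trans hq.1).1
  have h₀ := hc s₀ (hs₀.trans hr₀) subset_rfl
  have h₁ := hc s₁ (hs₁.trans hr₁) hd.symm.subset
  rw [piecewise_dom_g] at h₀
  rw [← hd, piecewise_dom_g] at h₁
  obtain ⟨t, htb, htd, htg⟩ := h₁.2 (h₀.1 ⟨s₀, b.lower hs₀ hr₀b, rfl, rfl⟩)
  obtain ⟨w, hwt, hws⟩ := exists_directLE_directLE (p := t) (q := s₁) htd.symm htg.symm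
  exact ⟨w, hws.1.trans hs₁, b.lower hwt.1 htb⟩

/-! ### Pruning and capturing direct extensions. -/

/-- The set of the points of `p.G γ` to which the pruned sets at smaller indices reflect. -/
noncomputable def pruneSet (p : Condition κ α U f) : Iio α → Set Ordinal.{u} :=
  WellFoundedLT.fix fun γ S => {ξ ∈ p.G γ | ∀ δ, ∀ hδ : δ < γ,
    (∀ β ∈ p.dom, ¬ (δ ≤ β ∧ β ≤ γ)) → S δ hδ ∩ Iio ξ ∈ f γ δ ξ}

theorem pruneSet_eq (p : Condition κ α U f) (γ : Iio α) : p.pruneSet γ =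
    {ξ ∈ p.G γ | ∀ δ < γ, (∀ β ∈ p.dom, ¬ (δ ≤ β ∧ β ≤ γ)) →
      p.pruneSet δ ∩ Iio ξ ∈ f γ δ ξ} := by
  rw [pruneSet, WellFoundedLT.fix_eq]

/-- Induction on `γ`: the earlier pruned sets have measure one, so by coherence and completeness
almost all points reflect all of them. -/
theorem pruneSet_mem_measure (hUf : IsMagidorSystem κ α U f) (p : Condition κ α U f)
    (γ : Iio α) (hγ : γ ∉ p.dom) : p.pruneSet γ ∈ p.measure γ := by
  induction γ using WellFoundedLT.induction with
  | ind γ ih =>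
    have hall : ∀ᶠ ξ in (p.measure γ : Filter Ordinal.{u}), ∀ δ, δ < γ →
        (∀ β ∈ p.dom, ¬ (δ ≤ β ∧ β ≤ γ)) → p.pruneSet δ ∩ Iio ξ ∈ f γ δ ξ :=
      (p.isNormalUltrafilter_measure hUf γ).eventually_forall_Iio (p.lt_bound hUf γ) fun δ => by
        by_cases h : δ < γ ∧ ∀ β ∈ p.dom, ¬ (δ ≤ β ∧ β ≤ γ)
        · have hδ : δ ∉ p.dom := fun hδ => h.2 δ hδ ⟨le_rfl, h.1.le⟩
          filter_upwards [(p.represents_measure hUf h.1 h.2 _).1 (ih δ h.1 hδ)]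
            with ξ hξ _ _ using hξ
        · exact .of_forall fun _ h1 h2 => (h ⟨h1, h2⟩).elim
    filter_upwards [p.G_mem_measure hγ, hall] with ξ h1 h2
    rw [pruneSet_eq]
    exact ⟨h1, h2⟩

theorem exists_isPruned_directLE (hUf : IsMagidorSystem κ α U f) (p : Condition κ α U f) :
    ∃ q : Condition κ α U f, q.IsPruned ∧ q.DirectLE p := by
  refine ⟨_, ?_, p.restrict_directLE p.pruneSet (p.pruneSet_mem_measure hUf)⟩
  have hsub : ∀ γ, p.pruneSet γ ⊆ p.G γ := fun γ => by
    rw [pruneSet_eq]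
    exact sep_subset _ _
  rintro γ hγ ξ ⟨-, hξ⟩ δ hδγ hδ
  rw [pruneSet_eq] at hξ
  change (p.G δ ∩ p.pruneSet δ) ∩ Iio ξ ∈ f γ δ ξ
  rw [inter_eq_self_of_subset_right (hsub δ)]
  exact hξ.2 δ hδγ hδ

/-- If the stem of `r` is allowed by a pruned condition `q`, then `r` has a direct extension
below `q`. -/
theorem IsPruned.exists_directLE_le {q : Condition κ α U f} (hq : q.IsPruned)
    {r : Condition κ α U f} (hd : q.dom ⊆ r.dom) (hg : ∀ γ ∈ q.dom, r.g γ = q.g γ)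
    (hG : ∀ γ ∈ r.dom, γ ∉ q.dom → r.g γ ∈ q.G γ) :
    ∃ w : Condition κ α U f, w.DirectLE r ∧ w ≤ q := by
  have hX : ∀ γ ∉ r.dom, q.G γ ∈ r.measure γ := by
    intro γ hγ
    have hγq : γ ∉ q.dom := fun h => hγ (hd h)
    cases hn : r.next γ with
    | top =>
      rw [measure_of_next_eq_top hn]
      exact q.G_mem_top γ hγq fun β hβ =>
        (next_eq_top.1 hn β (hd hβ)).lt_of_ne fun he => hγq (he ▸ hβ)
    | coe ρ =>
      rw [measure_of_next_eq_coe hn]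
      obtain ⟨h1, h2, h3⟩ := next_eq_coe.1 hn
      by_cases hρ : ρ ∈ q.dom
      · rw [hg ρ hρ]
        exact q.G_mem γ hγq ρ hρ h2 fun β hβ => h3 β (hd hβ)
      -- Here `r.g ρ` is a new point taken from `q.G ρ`, and prunedness says that `q.G γ` reflects
      -- to it; minimality of `ρ` excludes elements of `q.dom` in `[γ, ρ]`.
      · refine mem_of_superset (hq ρ hρ _ (hG ρ h1 hρ) γ h2 fun β hβ hγβ => hρ ?_)
          inter_subset_left
        have hlt : γ < β := hγβ.1.lt_of_ne fun he => hγq (he ▸ hβ)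
        rwa [(h3 β (hd hβ) hlt).antisymm hγβ.2]
  exact ⟨_, r.restrict_directLE q.G hX, hd, hg, hG, fun γ _ => inter_subset_right⟩

theorem capturesDirectExtensions (hUf : IsMagidorSystem κ α U f) {p : Condition κ α U f}
    (hp : p.dom = ∅) : Forcing.CapturesDirectExtensions DirectLE p := by
  intro A hA d hd
  choose e he hed using fun a => (d a).exists_isPruned_directLE hUf
  have hea : ∀ a ∈ A, (e a).DirectLE a := fun a ha => (hed a).trans (hd a ha)
  -- The quantifier over `a` makes this a property of the stem alone. It concerns at most one `a`,
  -- since members of `A` with equal stems are compatible.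
  obtain ⟨q, hq, hom⟩ := p.exists_directLE_homogeneous hUf fun γ E g =>
    ∀ a ∈ A, γ ∉ a.dom → E = insert γ a.dom → (∀ δ ∈ a.dom, g δ = a.g δ) → g γ ∈ (e a).G γ
  have hall : ∀ a ∈ A, ∀ γ ∉ a.dom, ∀ r ≤ q, r ≤ a → γ ∈ r.dom → r.g γ ∈ (e a).G γ := by
    intro a ha γ hγ r hrq hra hγr
    obtain ⟨c, hc⟩ := hom γ (insert γ a.dom) (by simp [hp])
    -- `r₀` need not be related to `a`: the truth value `c` depends only on `γ` and the domain, so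
    -- one witness with this domain determines it.
    obtain ⟨r₀, hr₀, hr₀d⟩ := q.exists_le_dom_eq_union hUf a.dom
    rw [hq.2.1, hp, Finset.union_empty] at hr₀d
    have hstem : ∀ a' ∈ A, ∀ s ≤ r₀, γ ∉ a'.dom → insert γ a.dom = insert γ a'.dom →
        (∀ δ ∈ a'.dom, (insert γ a.dom).piecewise s.g 0 δ = a'.g δ) →
        a'.dom = r₀.dom ∧ a'.g = r₀.g := by
      intro a' ha' s hs hγ' hE hg
      have hd' : a'.dom = r₀.dom := by
        rw [hr₀d, ← Finset.erase_insert hγ, hE, Finset.erase_insert hγ']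
      refine ⟨hd', g_eq_of_eqOn_dom hd' fun δ hδ => ?_⟩
      rw [← hg δ (hd' ▸ hδ), Finset.piecewise_eq_of_mem, hs.2.1 δ hδ]
      exact Finset.mem_insert_of_mem (hr₀d ▸ hδ)
    -- If the stem of `r₀` belongs to some `a'` in `A`, add a point at `γ` below both `r₀` and `e
    -- a'`; the property then holds for `a'`. Otherwise it holds vacuously.
    have hcTrue : c := by
      by_cases hex : ∃ a' ∈ A, a'.dom = r₀.dom ∧ a'.g = r₀.g
      · obtain ⟨a', ha', had, hag⟩ := hex
        obtain ⟨t, ht, hte⟩ := exists_directLE_directLE (p := r₀) (q := e a')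
          ((hea a' ha').2.1.trans had) ((hea a' ha').2.2.trans hag)
        obtain ⟨s, hs, hsd⟩ := t.exists_le_dom_eq_insert hUf γ
        rw [ht.2.1, hr₀d] at hsd
        refine (hc s ((hs.trans ht.1).trans hr₀) hsd.symm.subset).1 ?_
        intro a₂ ha₂ hγ₂ hE hg
        obtain ⟨h1, h2⟩ := hstem a₂ ha₂ s (hs.trans ht.1) hγ₂ hE hg
        obtain rfl : a₂ = a' := by
          by_contra hne
          obtain ⟨w, hw, hw'⟩ := exists_directLE_directLE (p := a₂) (q := a')
            (had.trans h1.symm) (hag.trans h2.symm)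
          exact hA a₂ ha₂ a' ha' hne ⟨w, hw.1, hw'.1⟩
        rw [Finset.piecewise_eq_of_mem _ _ _ (Finset.mem_insert_self _ _)]
        have hγs : γ ∈ s.dom := hsd ▸ Finset.mem_insert_self _ _
        exact (hs.trans hte.1).2.2.1 γ hγs (by rwa [(hea a₂ ha').2.1])
      · obtain ⟨s, hs, hsd⟩ := r₀.exists_le_dom_eq_insert hUf γ
        rw [hr₀d] at hsd
        refine (hc s (hs.trans hr₀) hsd.symm.subset).1 ?_
        exact fun a₂ ha₂ hγ₂ hE hg => (hex ⟨a₂, ha₂, hstem a₂ ha₂ s hs hγ₂ hE hg⟩).elim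
    have := (hc r hrq (Finset.insert_subset hγr hra.1)).2 hcTrue a ha hγ rfl fun δ hδ => by
      rw [Finset.piecewise_eq_of_mem _ _ _ (Finset.mem_insert_of_mem hδ), hra.2.1 δ hδ]
    rwa [Finset.piecewise_eq_of_mem _ _ _ (Finset.mem_insert_self _ _)] at this
  refine ⟨q, hq, fun a ha r hrq hra => ?_⟩
  obtain ⟨hle, hdom, hg⟩ := hea a ha
  obtain ⟨w, hw, hwe⟩ := (he a).exists_directLE_le (r := r) (hdom ▸ hra.1)
    (fun γ hγ => by rw [hg, hra.2.1 γ (hdom ▸ hγ)])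
    fun γ hγ hγe => hall a ha γ (hdom ▸ hγe) r hrq hra hγ
  exact ⟨w, hw.1, hwe.trans (hed a).1⟩

/-! ### The weakest condition and the suborder of pruned conditions. -/

theorem directed (p q r : Condition κ α U f) (hq : q.DirectLE p) (hr : r.DirectLE p) :
    ∃ s : Condition κ α U f, s.DirectLE p ∧ s ≤ q ∧ s ≤ r := by
  obtain ⟨s, hsq, hsr⟩ := exists_directLE_directLE (p := q) (q := r)
    (hr.2.1.trans hq.2.1.symm) (hr.2.2.trans hq.2.2.symm)
  exact ⟨s, hsq.trans hq, hsq.1, hsr.1⟩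

/-- The weakest condition. -/
def one (hUf : IsMagidorSystem κ α U f) : Condition κ α U f where
  dom := ∅
  g _ := 0
  G := goodSet κ α f
  g_dummy _ _ := rfl
  G_dummy γ hγ := (Finset.notMem_empty γ hγ).elim
  g_mem γ hγ := (Finset.notMem_empty γ hγ).elim
  g_strictMono β hβ := (Finset.notMem_empty β hβ).elim
  G_subset _ _ := subset_rfl
  G_mem_top _ _ _ := goodSet_mem hUf.lt (fun β _ => hUf.normal β)
    fun β η h _ => hUf.represents β η h
  G_mem _ _ ρ hρ := (Finset.notMem_empty ρ hρ).elim
  lt_of_mem_G _ _ β hβ := (Finset.notMem_empty β hβ).elim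
  mem_G_lt _ _ β hβ := (Finset.notMem_empty β hβ).elim

theorem isTop_one (hUf : IsMagidorSystem κ α U f) : IsTop (one hUf) := fun p =>
  ⟨Finset.empty_subset _, fun γ hγ => (Finset.notMem_empty γ hγ).elim,
    fun γ hγ _ => p.g_mem γ hγ, p.G_subset⟩

theorem isPruned_one (hUf : IsMagidorSystem κ α U f) : (one hUf).IsPruned :=
  fun _ _ _ hξ _ hδ _ => goodSet_inter_Iio_mem hδ hξ

theorem strongPrikryProperty (hUf : IsMagidorSystem κ α U f) :
    Forcing.StrongPrikryProperty (DirectLE (κ := κ) (α := α) (U := U) (f := f)) :=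
  .of_capturesDirectExtensions (isTop_one hUf) DirectLE.refl (fun _ _ h => h.1)
    (openPrikryProperty hUf) directed (fun _ _ _ => DirectLE.connected)
    (capturesDirectExtensions hUf rfl)

end Condition

/-- Prunedness allows any point of any `p.G γ` to be added to `p`. If every extension of `p` is
compatible with `q`, then each such point must be a possible value below `q`, which yields `p ≤ q`.
-/
theorem isSeparative_prunedCondition {κ α : Ordinal.{u}} {U : Iio α → Ultrafilter Ordinal.{u}}
    {f : Iio α → Iio α → Ordinal.{u} → Ultrafilter Ordinal.{u}}
    (hUf : IsMagidorSystem κ α U f) : Forcing.IsSeparative (PrunedCondition κ α U f) := by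
  rintro ⟨p, hp⟩ ⟨q, hq⟩ hpq
  have hext : ∀ γ ∉ p.dom, ∀ ξ ∈ p.G γ, (∀ s : Condition κ α U f, s ≤ q → γ ∈ s.dom → s.g γ ≠ ξ) →
      ∃ r ≤ (⟨p, hp⟩ : PrunedCondition κ α U f), ¬ Forcing.Compatible r ⟨q, hq⟩ := by
    intro γ hγ ξ hξ hs
    obtain ⟨r, hr, hrd, hrg⟩ := p.exists_le_insert hUf hγ hξ fun δ hδ h => hp γ hγ ξ hξ δ hδ h
    obtain ⟨r', hr', hr'r⟩ := r.exists_isPruned_directLE hUf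
    refine ⟨⟨r', hr'⟩, hr'r.1.trans hr, ?_⟩
    rintro ⟨⟨s, _⟩, hsr, hsq⟩
    have hsr' : s ≤ r := le_trans (show s ≤ r' from hsr) hr'r.1
    have hγr : γ ∈ r.dom := hrd ▸ Finset.mem_insert_self _ _
    exact hs s hsq (hsr'.1 hγr) ((hsr'.2.1 γ hγr).trans hrg)
  by_contra! hcon
  refine hpq (show p ≤ q from ?_)
  obtain ⟨⟨s, _⟩, hsp, hsq⟩ := hcon ⟨p, hp⟩ le_rfl
  replace hsp : s ≤ p := hsp
  replace hsq : s ≤ q := hsq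
  have hdom : q.dom ⊆ p.dom := by
    intro γ hγ
    by_contra hγp
    have hN := p.isNormalUltrafilter_measure hUf γ
    -- If `γ` were in `q.dom` but not in `p.dom`, nonprincipality would give a point of `p.G γ`
    -- other than `q.g γ`; adding it contradicts `q`.
    obtain ⟨ξ, hξ, hne⟩ := (p.measure γ).nonempty_of_mem (inter_mem (p.G_mem_measure hγp)
      (Ultrafilter.compl_mem_iff_notMem.2 (hN.nonprincipal (q.g γ))))
    obtain ⟨r, hr, hrq⟩ := hext γ hγp ξ hξ fun t ht _ he => hne (he.symm.trans (ht.2.1 γ hγ))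
    exact hrq (hcon r hr)
  refine ⟨hdom, fun γ hγ => ?_, fun γ hγ hγq => ?_, fun γ hγ ξ hξ => ?_⟩
  · rw [← hsp.2.1 γ (hdom hγ), hsq.2.1 γ hγ]
  · rw [← hsp.2.1 γ hγ]
    exact hsq.2.2.1 γ (hsp.1 hγ) hγq
  · by_contra hξq
    obtain ⟨r, hr, hrq⟩ := hext γ hγ ξ hξ fun t ht hγt he =>
      hξq (he ▸ ht.2.2.1 γ hγt fun h => hγ (hdom h))
    exact hrq (hcon r hr)

theorem PrunedCondition.strongPrikryProperty {κ α : Ordinal.{u}}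
    {U : Iio α → Ultrafilter Ordinal.{u}}
    {f : Iio α → Iio α → Ordinal.{u} → Ultrafilter Ordinal.{u}} (hUf : IsMagidorSystem κ α U f) :
    Forcing.StrongPrikryProperty
      (PrunedCondition.DirectLE (κ := κ) (α := α) (U := U) (f := f)) := by
  have htrans : ∀ p q r : Condition κ α U f, r.DirectLE q → q.DirectLE p → r.DirectLE p :=
    fun _ _ _ => Condition.DirectLE.trans
  have hle : ∀ q p : Condition κ α U f, q.DirectLE p → q ≤ p := fun _ _ h => h.1
  have hprune := Condition.exists_isPruned_directLE hUf
  have hcap := Condition.capturesDirectExtensions hUf (p := Condition.one hUf) rfl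
  let one : PrunedCondition κ α U f := ⟨Condition.one hUf, Condition.isPruned_one hUf⟩
  refine .of_capturesDirectExtensions (one := one)
    (fun p => Condition.isTop_one hUf p.1) (fun p => Condition.DirectLE.refl p.1)
    (fun q p => hle q.1 p.1) ((Condition.openPrikryProperty hUf).subtype htrans hle hprune)
    (fun p q r hq hr => ?_) (fun _ _ _ => Condition.DirectLE.connected)
    (hcap.subtype (one := one) htrans hle hprune)
  obtain ⟨s, hs, hsq, hsr⟩ := Condition.directed p.1 q.1 r.1 hq hr
  obtain ⟨s', hs', hs's⟩ := hprune s
  exact ⟨⟨s', hs'⟩, hs's.trans hs, hs's.1.trans hsq, hs's.1.trans hsr⟩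

end Magidor

theorem mainTheorem4 (κ α : Ordinal.{u}) (U : Set.Iio α → Ultrafilter Ordinal.{u})
    (f : Set.Iio α → Set.Iio α → Ordinal.{u} → Ultrafilter Ordinal.{u})
    (hUf : Magidor.IsMagidorSystem κ α U f) :
    Forcing.StrongPrikryProperty
        (Magidor.Condition.DirectLE (κ := κ) (α := α) (U := U) (f := f)) ∧
      (∀ p : Magidor.Condition κ α U f, ∃ q : Magidor.Condition κ α U f,
        q.IsPruned ∧ q.DirectLE p) ∧
      Forcing.IsSeparative (Magidor.PrunedCondition κ α U f) ∧
      Forcing.StrongPrikryProperty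
        (Magidor.PrunedCondition.DirectLE (κ := κ) (α := α) (U := U) (f := f)) := by
  exact ⟨Magidor.Condition.strongPrikryProperty hUf,
    Magidor.Condition.exists_isPruned_directLE hUf, Magidor.isSeparative_prunedCondition hUf,
    Magidor.PrunedCondition.strongPrikryProperty hUf⟩
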